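/- Let $\Omega$ be a finite sample space and let $\Delta(\Omega)$ be the measurable space of probability mass functions on $\Omega$. Let $X_1,\dots,X_n$ ($n\ge 0$) be random variables on $\Omega$ with values in finite sets, and for $A\subseteq[n]=\{1,\dots,n\}$ let $X_A$ be the joint variable of the $X_i$, $i\in A$ (a constant if $A=\emptyset$). For a random variable $X$ let $[I(X)](P)=-\sum_x P(x)\log P(x)$ be its Shannon entropy and, for measurable $f:\Delta(\Omega)\to\mathbb R$, let $[X.f](P)=\sum_{x:\,P(x)\ne 0}P(x)\,f(P|_{X=x})$; here $P(x)=P(X=x)$. Put $I_1=I$ and $I_{q}(Y_1;\dots;Y_q)=I_{q-1}(Y_1;\dots;Y_{q-1})-Y_q.I_{q-1}(Y_1;\dots;Y_{q-1})$ for $q\ge 2$. Let $\widetilde X=\{p_W : \emptyset\ne W\subseteq[n]\}$ be a set of $2^n-1$ distinct atoms, and for $L\subseteq[n]$ let $\widetilde X_L=\{p_W : W\cap L\neq\emptyset\}$. Then there is exactly one function $\widetilde I$ from the subsets of $\widetilde X$ to the measurable functions $\Delta(\Omega)\to\mathbb R$ that is additive on disjoint unions and satisfies, for all $q\ge 1$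 and $J,L_1,\dots,L_q\subseteq[n]$, $$X_J.I_q(X_{L_1};\dots;X_{L_q})=\widetilde I\Big(\bigcap_{k=1}^q\widetilde X_{L_k}\setminus\widetilde X_J\Big).$$ For $P\in\Delta(\Omega)$ let $\widetilde I^P(A)=[\widetilde I(A)](P)$ be the slice of this entropy diagram at $P$. Let $G$ be a finite simple graph with vertex set $[n]$ and let $P\in\Delta(\Omega)$. Then the following are equivalent: 1. $X_1,\dots,X_n$ form a $P$-Markov random field for $G$, that is: for all pairwise disjoint $A,B,C\subseteq[n]$ such that every walk in $G$ from a vertex of $A$ to a vertex of $B$ passes through a vertex of $C$, the variables $X_A$ and $X_B$ are independent given $X_C$ under $P$, i.e. $P(x_A,x_B,x_C)=P(x_A\mid x_C)\,P(x_B,x_C)$ for all values (the right-hand side being zero if $P(x_C)=0$). 2. $\widetilde I^P(\{p_W\})=0$ for every atom $p_W$ that is disconnected with respect to $G$, that is, for which the graph obtained from $G$ by removing the vertices outside $W$ has more than one connected component. -/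

import Mathlib

namespace EntropyDiagram

noncomputable section

universe u v

/-- The space of probability mass functions on the finite sample space `Ω`, with the measurable
structure induced from `Ω → ℝ`. -/
abbrev Simplex (Ω : Type u) [Fintype Ω] : Type u := stdSimplex ℝ Ω

/-- A (finite) discrete random variable on the sample space `Ω`. -/
structure DiscreteRV (Ω : Type u) where
  Val : Type v
  [fintypeVal : Fintype Val]
  toFun : Ω → Val

attribute [instance] DiscreteRV.fintypeVal

namespace DiscreteRV

variable {Ω : Type u}

/-- The joint variable `XY`. -/
def prod (X Y : DiscreteRV.{u, v} Ω) : DiscreteRV.{u, v} Ω where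
  Val := X.Val × Y.Val
  toFun ω := (X.toFun ω, Y.toFun ω)

/-- The joint variable `X_A` of the variables `X i` with `i ∈ A`
(a constant variable if `A` is empty). -/
def joint {n : ℕ} (X : Fin n → DiscreteRV.{u, v} Ω) (A : Finset (Fin n)) :
    DiscreteRV.{u, v} Ω where
  Val := (i : A) → (X i).Val
  toFun ω := fun i => (X i).toFun ω

variable [Fintype Ω]

open Classical in
/-- The law `P_X(x) = ∑_{ω ∈ X⁻¹(x)} P(ω)`. -/
def law (X : DiscreteRV.{u, v} Ω) (P : Simplex Ω) (x : X.Val) : ℝ :=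
  ∑ ω with X.toFun ω = x, P.1 ω

open Classical in
/-- The conditional distribution `P|_{X = x}`, for `P_X(x) ≠ 0`. -/
def cond (X : DiscreteRV.{u, v} Ω) (P : Simplex Ω) (x : X.Val) (h : X.law P x ≠ 0) :
    Simplex Ω :=
  ⟨fun ω => (if X.toFun ω = x then P.1 ω else 0) / X.law P x, by
    constructor
    · intro ω
      have h0 : 0 ≤ X.law P x := Finset.sum_nonneg fun ω _ => P.2.1 ω
      have h1 : 0 ≤ (if X.toFun ω = x then P.1 ω else 0) := by
        split_ifs
        · exact P.2.1 ω
        · exact le_rfl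
      exact div_nonneg h1 h0
    · rw [← Finset.sum_div, ← Finset.sum_filter]
      exact div_self h⟩

open Classical in
/-- The conditional probability `P(x ∣ z)`, set to zero if `P(z) = 0`. -/
def condLaw (X Z : DiscreteRV.{u, v} Ω) (P : Simplex Ω) (x : X.Val) (z : Z.Val) : ℝ :=
  if h : Z.law P z ≠ 0 then X.law (Z.cond P z h) x else 0

/-- `X` and `Y` are `P`-independent given `Z`: `P(x, y, z) = P(x ∣ z) P(y, z)` for all
values `x, y, z`. -/
def CondIndep (P : Simplex Ω) (X Y Z : DiscreteRV.{u, v} Ω) : Prop :=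
  ∀ (x : X.Val) (y : Y.Val) (z : Z.Val),
    (X.prod (Y.prod Z)).law P (x, y, z) = X.condLaw Z P x z * (Y.prod Z).law P (y, z)

/-- Shannon entropy, as a function of the distribution (`0 * log 0 = 0`). -/
def entropy (X : DiscreteRV.{u, v} Ω) : Simplex Ω → ℝ :=
  fun P => -∑ x, X.law P x * Real.log (X.law P x)

open Classical in
/-- The conditioning action `[X.f](P) = ∑_x P(x) f(P|_{X = x})`, where terms with `P(x) = 0`
are zero. -/
def act (X : DiscreteRV.{u, v} Ω) (f : Simplex Ω → ℝ) : Simplex Ω → ℝ :=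
  fun P => ∑ x, if h : X.law P x ≠ 0 then X.law P x * f (X.cond P x h) else 0

/-- The higher-order information function `I_{q+1}(Y₁; …; Y_{q+1})`: `I₁` is the entropy, and
`I_{q+2}(Y₁; …; Y_{q+2}) = I_{q+1}(Y₁; …; Y_{q+1}) - Y_{q+2}.I_{q+1}(Y₁; …; Y_{q+1})`. -/
def interaction : (q : ℕ) → (Fin (q + 1) → DiscreteRV.{u, v} Ω) → Simplex Ω → ℝ
  | 0, Y => entropy (Y 0)
  | q + 1, Y =>
    interaction q (Fin.init Y) - act (Y (Fin.last (q + 1))) (interaction q (Fin.init Y))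

end DiscreteRV

/-- The atoms `p_I` of the diagram, indexed by the nonempty `I ⊆ {1, …, n}`. -/
abbrev Atom (n : ℕ) : Type := {I : Finset (Fin n) // I.Nonempty}

/-- The union of the circles `{p_I ∣ i ∈ I}` over `i ∈ L`. -/
def region {n : ℕ} (L : Finset (Fin n)) : Set (Atom n) :=
  ⋃ i ∈ L, {p : Atom n | i ∈ p.1}

/-- `μ` is the entropy diagram of `X 0, …, X (n - 1)`: a finitely additive measure on the sets of
atoms, with values in the group of measurable functions on the space of mass functions, that
satisfies Hu's identity. -/
structure IsEntropyDiagram {Ω : Type u} [Fintype Ω] {n : ℕ} (X : Fin n → DiscreteRV.{u, v} Ω)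
    (μ : Set (Atom n) → Simplex Ω → ℝ) : Prop where
  measurable : ∀ S, Measurable (μ S)
  additive : ∀ S T, Disjoint S T → μ (S ∪ T) = μ S + μ T
  hu : ∀ (q : ℕ) (J : Finset (Fin n)) (L : Fin (q + 1) → Finset (Fin n)),
    (DiscreteRV.joint X J).act
        (DiscreteRV.interaction q fun k => DiscreteRV.joint X (L k)) =
      μ ((⋂ k, region (L k)) \ region J)

/-- The slice at `P` of a function-valued measure. -/
def slice {Ω : Type u} [Fintype Ω] {n : ℕ} (μ : Set (Atom n) → Simplex Ω → ℝ) (P : Simplex Ω) :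
    Set (Atom n) → ℝ :=
  fun S => μ S P

/-- `C` separates `A` from `B`: every walk from a vertex of `A` to a vertex of `B` passes through
a vertex of `C`. -/
def Separates {n : ℕ} (G : SimpleGraph (Fin n)) (C A B : Finset (Fin n)) : Prop :=
  ∀ a ∈ A, ∀ b ∈ B, ∀ w : G.Walk a b, ∃ c ∈ C, c ∈ w.support

/-- `P`-Markov random fields, by the global Markov property. -/
def IsMarkovRandomField {Ω : Type u} [Fintype Ω] {n : ℕ} (P : Simplex Ω)
    (X : Fin n → DiscreteRV.{u, v} Ω) (G : SimpleGraph (Fin n)) : Prop :=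
  ∀ A B C : Finset (Fin n), Disjoint A B → Disjoint A C → Disjoint B C → Separates G C A B →
    DiscreteRV.CondIndep P (DiscreteRV.joint X A) (DiscreteRV.joint X B) (DiscreteRV.joint X C)

/-- `U` is a cutset: the graph obtained by removing `U` has more than one connected component. -/
def IsCutset {n : ℕ} (G : SimpleGraph (Fin n)) (U : Finset (Fin n)) : Prop :=
  1 < Nat.card (G.induce {i | i ∉ U}).ConnectedComponent

/-- The atom `p_W` is disconnected: the complement of `W` is a cutset. -/
def IsDisconnectedAtom {n : ℕ} (G : SimpleGraph (Fin n)) (W : Atom n) : Prop :=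
  IsCutset G (Finset.univ \ W.1)

end

end EntropyDiagram

namespace EntropyDiagram

/-! ### Möbius inversion on the subsets of a finite set. -/

section AlternatingSums

variable {M : Type*} [AddCommGroup M]

/-! Möbius inversion of `A ↦ H(X_A)` gives each atom a mass, `atomMass`, such that `H(X_A)` is the
total mass of the atoms meeting `A`. By the chain rule, conditioning on `X_J` deletes exactly the
atoms meeting `J` (`act_atomMass`), so Hu's identity follows by induction on `q`. It determines the
measure, since every singleton is an intersection of regions minus a region.

For the Markov statement, conditional independence is an equality of entropies
(`condIndep_iff_entropy`, from Gibbs' inequality). In terms of atoms it says that those meeting `A`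
and `B` but not `C` have total mass zero at `P`. If `C` separates `A` from `B`, all these atoms are
disconnected, so 2 implies 1. Conversely, a disconnected `W` splits into two parts separated by its
complement; on sets containing that complement the entropy is then a sum of terms each blind to one
part, and the alternating sum defining the mass cancels (`atomMass_eq_zero_of_splits`). -/

theorem sum_powerset_neg_one_pow_smul_eq_zero {α : Type*} [DecidableEq α] {W : Finset α} {j : α}
    (hj : j ∈ W) (f : Finset α → M) (hf : ∀ V ⊆ W.erase j, f (insert j V) = f V) :
    ∑ V ∈ W.powerset, (-1 : ℤ) ^ V.card • f V = 0 := by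
  conv_lhs => rw [← Finset.insert_erase hj]
  rw [Finset.sum_powerset_insert (Finset.notMem_erase j W), ← Finset.sum_add_distrib]
  refine Finset.sum_eq_zero fun V hV => ?_
  have hV' := Finset.mem_powerset.1 hV
  have hjV : j ∉ V := fun h => Finset.notMem_erase j W (hV' h)
  rw [hf V hV', Finset.card_insert_of_notMem hjV, pow_succ]
  simp

/-- The Möbius inverse of the function `h` on subsets of `Fin n`, evaluated at the atom `W`. -/
def atomMass {n : ℕ} (h : Finset (Fin n) → M) (W : Finset (Fin n)) : M :=
  -∑ V ∈ W.powerset, (-1 : ℤ) ^ V.card • h (Wᶜ ∪ V)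

/-- Forgetting the variable `a` merges the atoms `W` and `insert a W`. -/
theorem atomMass_add_atomMass_insert {n : ℕ} (h : Finset (Fin n) → M) {W : Finset (Fin n)}
    {a : Fin n} (ha : a ∉ W) :
    atomMass h W + atomMass h (insert a W) = atomMass (fun B => h (B.erase a)) W := by
  unfold atomMass
  rw [Finset.sum_powerset_insert ha, ← neg_add, ← add_assoc, add_right_comm,
    ← Finset.sum_add_distrib]
  have h0 : ∑ V ∈ W.powerset, ((-1 : ℤ) ^ V.card • h (Wᶜ ∪ V) +
      (-1 : ℤ) ^ (insert a V).card • h ((insert a W)ᶜ ∪ insert a V)) = 0 := by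
    refine Finset.sum_eq_zero fun V hV => ?_
    have haV : a ∉ V := fun h => ha (Finset.mem_powerset.1 hV h)
    have : (insert a W)ᶜ ∪ insert a V = Wᶜ ∪ V := by grind [Finset.mem_compl]
    rw [this, Finset.card_insert_of_notMem haV, pow_succ]
    simp
  rw [h0, zero_add]
  congr 1
  refine Finset.sum_congr rfl fun V hV => ?_
  have haV : a ∉ V := fun h => ha (Finset.mem_powerset.1 hV h)
  have : (insert a W)ᶜ ∪ V = (Wᶜ ∪ V).erase a := by grind [Finset.mem_compl]
  rw [this]

theorem sum_powerset_atomMass {n : ℕ} (D : Finset (Fin n)) (h : Finset (Fin n) → M) :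
    ∑ W ∈ D.powerset, atomMass h W = -h Dᶜ := by
  -- The inductive step replaces `h` by `h` with `a` forgotten, so `h` must vary.
  induction D using Finset.induction_on generalizing h with
  | empty => simp [atomMass]
  | insert a D ha ih =>
    rw [Finset.sum_powerset_insert ha, ← Finset.sum_add_distrib]
    have : ∀ W ∈ D.powerset, atomMass h W + atomMass h (insert a W)
        = atomMass (fun B => h (B.erase a)) W := fun W hW =>
      atomMass_add_atomMass_insert h fun hh => ha (Finset.mem_powerset.1 hW hh)
    rw [Finset.sum_congr rfl this, ih]
    congr 2
    ext i
    simp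

theorem sum_atomMass_eq {n : ℕ} (h : Finset (Fin n) → M) (h0 : h ∅ = 0) (A : Finset (Fin n)) :
    ∑ W : Finset (Fin n) with ¬Disjoint W A, atomMass h W = h A := by
  have h1 := sum_powerset_atomMass Finset.univ h
  rw [Finset.powerset_univ, Finset.compl_univ, h0, neg_zero,
    ← Finset.sum_filter_add_sum_filter_not _ (fun W => Disjoint W A)] at h1
  have h2 := sum_powerset_atomMass Aᶜ h
  have h3 : (Aᶜ).powerset = Finset.univ.filter (fun W => Disjoint W A) := by
    ext W
    simp [Finset.subset_compl_iff_disjoint_right]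
  rw [h3, compl_compl] at h2
  rw [h2] at h1
  exact (neg_add_eq_zero.1 h1).symm

end AlternatingSums

/-! ### Laws, entropy and the chain rule. -/

namespace DiscreteRV

universe u v
variable {Ω : Type u}

theorem toFun_joint_eq_iff {n : ℕ} (X : Fin n → DiscreteRV.{u, v} Ω) (A : Finset (Fin n))
    (ω ω' : Ω) : (joint X A).toFun ω = (joint X A).toFun ω' ↔
      ∀ i ∈ A, (X i).toFun ω = (X i).toFun ω' := by
  simp [joint, funext_iff]

theorem toFun_prod_eq_iff (X Y : DiscreteRV.{u, v} Ω) (ω ω' : Ω) :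
    (X.prod Y).toFun ω = (X.prod Y).toFun ω' ↔
      X.toFun ω = X.toFun ω' ∧ Y.toFun ω = Y.toFun ω' := by
  simp [prod]

variable [Fintype Ω]

theorem law_nonneg (X : DiscreteRV.{u, v} Ω) (P : Simplex Ω) (x : X.Val) : 0 ≤ X.law P x :=
  Finset.sum_nonneg fun ω _ => P.2.1 ω

open Classical in
theorem law_eq_sum_ite (X : DiscreteRV.{u, v} Ω) (P : Simplex Ω) (x : X.Val) :
    X.law P x = ∑ ω, if X.toFun ω = x then P.1 ω else 0 := by
  rw [law, Finset.sum_filter]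

open Classical in
theorem law_prod_eq_sum_ite (X Y : DiscreteRV.{u, v} Ω) (P : Simplex Ω) (x : X.Val) (y : Y.Val) :
    (X.prod Y).law P (x, y) = ∑ ω, if X.toFun ω = x ∧ Y.toFun ω = y then P.1 ω else 0 := by
  refine (law_eq_sum_ite (X.prod Y) P (x, y)).trans
    (Finset.sum_congr rfl fun ω _ => if_congr ?_ rfl rfl)
  exact Prod.mk_inj

theorem sum_law_mul (X : DiscreteRV.{u, v} Ω) (P : Simplex Ω) (g : X.Val → ℝ) :
    ∑ x, X.law P x * g x = ∑ ω, P.1 ω * g (X.toFun ω) := by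
  classical
  simp_rw [law_eq_sum_ite, Finset.sum_mul]
  rw [Finset.sum_comm]
  refine Finset.sum_congr rfl fun ω _ => ?_
  simp

theorem entropy_eq (X : DiscreteRV.{u, v} Ω) (P : Simplex Ω) :
    X.entropy P = -∑ ω, P.1 ω * Real.log (X.law P (X.toFun ω)) := by
  rw [entropy, sum_law_mul X P (fun x => Real.log (X.law P x))]

theorem le_law (X : DiscreteRV.{u, v} Ω) (P : Simplex Ω) (ω : Ω) :
    P.1 ω ≤ X.law P (X.toFun ω) := by
  classical
  exact Finset.single_le_sum (f := fun ω => P.1 ω) (fun i _ => P.2.1 i) (by simp)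

theorem law_congr {X Y : DiscreteRV.{u, v} Ω} {x : X.Val} {y : Y.Val}
    (h : ∀ ω, X.toFun ω = x ↔ Y.toFun ω = y) (P : Simplex Ω) : X.law P x = Y.law P y := by
  classical
  simp only [law, h]

theorem entropy_congr {X Y : DiscreteRV.{u, v} Ω}
    (h : ∀ ω ω', X.toFun ω = X.toFun ω' ↔ Y.toFun ω = Y.toFun ω') : X.entropy = Y.entropy := by
  funext P
  rw [entropy_eq, entropy_eq]
  congr 1
  refine Finset.sum_congr rfl fun ω _ => ?_
  rw [law_congr (fun ω' => h ω' ω) P]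

theorem law_cond (X Y : DiscreteRV.{u, v} Ω) (P : Simplex Ω) (x : X.Val) (h : X.law P x ≠ 0)
    (y : Y.Val) : Y.law (X.cond P x h) y = (Y.prod X).law P (y, x) / X.law P x := by
  classical
  rw [law_eq_sum_ite, law_prod_eq_sum_ite, Finset.sum_div]
  refine Finset.sum_congr rfl fun ω _ => ?_
  simp only [cond]
  split_ifs <;> simp_all

theorem condLaw_eq (X Z : DiscreteRV.{u, v} Ω) (P : Simplex Ω) (x : X.Val) (z : Z.Val) :
    X.condLaw Z P x z = (X.prod Z).law P (x, z) / Z.law P z := by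
  unfold condLaw
  split_ifs with h
  · exact law_cond Z X P z h x
  · rw [not_not.1 h, div_zero]

theorem act_entropy (X Y : DiscreteRV.{u, v} Ω) :
    X.act Y.entropy = (X.prod Y).entropy - X.entropy := by
  classical
  funext P
  have h1 : ∀ x, (if h : X.law P x ≠ 0 then X.law P x * Y.entropy (X.cond P x h) else 0) =
      -∑ ω, (if X.toFun ω = x then P.1 ω * (Real.log ((X.prod Y).law P ((X.prod Y).toFun ω)) -
        Real.log (X.law P (X.toFun ω))) else 0) := by
    intro x
    split_ifs with h
    · rw [entropy_eq, mul_neg, Finset.mul_sum]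
      congr 1
      refine Finset.sum_congr rfl fun ω _ => ?_
      rw [law_cond]
      simp only [cond]
      split_ifs with hx
      · by_cases hω : P.1 ω = 0
        · simp [hω]
        -- Positive weight makes both laws nonzero at `ω`, so the logarithm of the quotient splits.
        have hpos : 0 < P.1 ω := lt_of_le_of_ne (P.2.1 ω) (Ne.symm hω)
        have h2 : (Y.prod X).law P (Y.toFun ω, x) = (X.prod Y).law P ((X.prod Y).toFun ω) := by
          apply law_congr
          intro ω'
          simp only [prod, Prod.mk.injEq, hx]
          tauto
        have h3 := hpos.trans_le (le_law (X.prod Y) P ω)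
        rw [h2, Real.log_div h3.ne' h, hx]
        field_simp
      · simp
    · have h0 := not_not.1 h
      symm
      rw [neg_eq_zero]
      refine Finset.sum_eq_zero fun ω _ => ?_
      split_ifs with hx
      · have := le_law X P ω
        rw [hx, h0] at this
        rw [le_antisymm this (P.2.1 ω), zero_mul]
      · rfl
  rw [act, Finset.sum_congr rfl fun x _ => h1 x, Finset.sum_neg_distrib, Finset.sum_comm,
    Pi.sub_apply, entropy_eq, entropy_eq]
  simp only [Finset.sum_ite_eq, Finset.mem_univ, if_true, mul_sub, Finset.sum_sub_distrib]
  ring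

/-- The conditioning action as an additive map. -/
noncomputable def actHom (X : DiscreteRV.{u, v} Ω) : (Simplex Ω → ℝ) →+ (Simplex Ω → ℝ) where
  toFun := X.act
  map_zero' := by
    funext P
    simp [act]
  map_add' f g := by
    funext P
    simp only [act, Pi.add_apply, ← Finset.sum_add_distrib]
    refine Finset.sum_congr rfl fun x _ => ?_
    split_ifs <;> ring

theorem actHom_apply (X : DiscreteRV.{u, v} Ω) (f : Simplex Ω → ℝ) : X.actHom f = X.act f := rfl

theorem measurable_entropy (X : DiscreteRV.{u, v} Ω) : Measurable X.entropy := by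
  classical
  have h : ∀ x, Measurable fun P : Simplex Ω => X.law P x := fun x =>
    Finset.measurable_sum _ fun ω _ => (measurable_pi_apply ω).comp measurable_subtype_coe
  exact (Finset.measurable_sum _ fun x _ =>
    (h x).mul (Real.measurable_log.comp (h x))).neg

theorem entropy_joint_prod {n : ℕ} (X : Fin n → DiscreteRV.{u, v} Ω) (A B : Finset (Fin n)) :
    ((joint X A).prod (joint X B)).entropy = (joint X (A ∪ B)).entropy := by
  refine entropy_congr fun ω ω' => ?_
  simp only [toFun_prod_eq_iff, toFun_joint_eq_iff, Finset.mem_union]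
  grind

theorem sum_coe_simplex (P : Simplex Ω) : ∑ ω, P.1 ω = 1 := P.2.2

theorem entropy_joint_empty {n : ℕ} (X : Fin n → DiscreteRV.{u, v} Ω) :
    (joint X ∅).entropy = 0 := by
  funext P
  rw [entropy_eq, Pi.zero_apply, neg_eq_zero]
  refine Finset.sum_eq_zero fun ω _ => ?_
  have : (joint X ∅).law P ((joint X ∅).toFun ω) = 1 := by
    classical
    rw [law, Finset.filter_true_of_mem, sum_coe_simplex]
    intro ω' _
    simp [toFun_joint_eq_iff]
  rw [this, Real.log_one, mul_zero]

/-! ### Gibbs' inequality and conditional independence. -/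

theorem sum_law (X : DiscreteRV.{u, v} Ω) (P : Simplex Ω) : ∑ x, X.law P x = 1 := by
  have := sum_law_mul X P fun _ => 1
  simpa [sum_coe_simplex] using this

theorem sum_law_prod_left (X Y : DiscreteRV.{u, v} Ω) (P : Simplex Ω) (y : Y.Val) :
    ∑ x, (X.prod Y).law P (x, y) = Y.law P y := by
  classical
  refine (Finset.sum_congr rfl fun x _ => law_prod_eq_sum_ite X Y P x y).trans ?_
  rw [Finset.sum_comm, law_eq_sum_ite]
  refine Finset.sum_congr rfl fun ω _ => ?_
  by_cases h : Y.toFun ω = y <;> simp [h]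

theorem law_prod_le_right (X Y : DiscreteRV.{u, v} Ω) (P : Simplex Ω) (x : X.Val) (y : Y.Val) :
    (X.prod Y).law P (x, y) ≤ Y.law P y := by
  rw [← sum_law_prod_left X]
  exact Finset.single_le_sum (f := fun x => (X.prod Y).law P (x, y))
    (fun i _ => law_nonneg _ _ _) (Finset.mem_univ x)

/-- This is `log t ≤ t - 1` at `t = q / p`, with equality only at `t = 1`. -/
theorem gibbs_term {p q : ℝ} (hp : 0 ≤ p) (hq : 0 ≤ q) (hpq : q = 0 → p = 0) :
    p - q ≤ p * Real.log (p / q) ∧ (p * Real.log (p / q) = p - q → p = q) := by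
  rcases hp.eq_or_lt with rfl | hp
  · simp only [zero_mul, zero_div]
    exact ⟨by linarith, fun h => by linarith⟩
  have hq' : 0 < q := lt_of_le_of_ne hq fun h => hp.ne' (hpq h.symm)
  have hr : 0 < q / p := div_pos hq' hp
  have hlog : Real.log (p / q) = -Real.log (q / p) := by
    rw [← Real.log_inv, inv_div]
  have hm : p * (q / p) = q := by field_simp
  rw [hlog]
  refine ⟨by nlinarith [Real.log_le_sub_one_of_pos hr], fun h => ?_⟩
  by_contra hne
  have h1 : q / p ≠ 1 := fun h1 => hne ((div_eq_one_iff_eq hp.ne').1 h1).symm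
  nlinarith [Real.log_lt_sub_one_of_pos hr h1]

/-- The entropy defect is the relative entropy of the joint law `p` to `q = P(x ∣ z) P(y, z)`. Both
have total mass 1, so it vanishes exactly when `p = q`. -/
theorem condIndep_iff_entropy (P : Simplex Ω) (X Y Z : DiscreteRV.{u, v} Ω) :
    CondIndep P X Y Z ↔ (X.prod Z).entropy P + (Y.prod Z).entropy P =
      (X.prod (Y.prod Z)).entropy P + Z.entropy P := by
  set p : X.Val × Y.Val × Z.Val → ℝ := fun t => (X.prod (Y.prod Z)).law P t with hp
  set q : X.Val × Y.Val × Z.Val → ℝ := fun t =>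
    (X.prod Z).law P (t.1, t.2.2) / Z.law P t.2.2 * (Y.prod Z).law P (t.2.1, t.2.2) with hq
  have hp0 : ∀ t, 0 ≤ p t := fun t => law_nonneg _ _ _
  have hq0 : ∀ t, 0 ≤ q t := fun t =>
    mul_nonneg (div_nonneg (law_nonneg _ _ _) (law_nonneg _ _ _)) (law_nonneg _ _ _)
  have hle1 : ∀ t, p t ≤ (Y.prod Z).law P (t.2.1, t.2.2) := fun t =>
    law_prod_le_right X (Y.prod Z) P t.1 t.2
  have hle2 : ∀ t, p t ≤ (X.prod Z).law P (t.1, t.2.2) := fun t => by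
    refine le_trans (le_of_eq ?_) (law_prod_le_right Y (X.prod Z) P t.2.1 (t.1, t.2.2))
    refine law_congr (fun ω => ?_) P
    simp only [prod, Prod.ext_iff]
    tauto
  have hle3 : ∀ t, p t ≤ Z.law P t.2.2 := fun t =>
    (hle1 t).trans (law_prod_le_right Y Z P _ _)
  have hpq : ∀ t, q t = 0 → p t = 0 := by
    intro t ht
    refine le_antisymm ?_ (hp0 t)
    rcases mul_eq_zero.1 ht with h | h
    · rcases div_eq_zero_iff.1 h with h | h
      · exact h ▸ hle2 t
      · exact h ▸ hle3 t
    · exact h ▸ hle1 t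
  have hlog : ∀ t, p t * Real.log (p t / q t) = p t * (Real.log (p t) + Real.log (Z.law P t.2.2) -
      Real.log ((X.prod Z).law P (t.1, t.2.2)) - Real.log ((Y.prod Z).law P (t.2.1, t.2.2))) := by
    intro t
    rcases (hp0 t).eq_or_lt with h | h
    · rw [← h, zero_mul, zero_mul]
    have h1 := (h.trans_le (hle1 t)).ne'
    have h2 := (h.trans_le (hle2 t)).ne'
    have h3 := (h.trans_le (hle3 t)).ne'
    rw [Real.log_div h.ne' (mul_ne_zero (div_ne_zero h2 h3) h1),
      Real.log_mul (div_ne_zero h2 h3) h1, Real.log_div h2 h3]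
    ring
  have hsum : ∑ t, p t * Real.log (p t / q t) = (X.prod Z).entropy P + (Y.prod Z).entropy P -
      (X.prod (Y.prod Z)).entropy P - Z.entropy P := by
    simp_rw [hlog]
    refine (sum_law_mul (X.prod (Y.prod Z)) P (fun t => Real.log (p t) + Real.log (Z.law P t.2.2) -
      Real.log ((X.prod Z).law P (t.1, t.2.2)) - Real.log ((Y.prod Z).law P (t.2.1, t.2.2)))).trans ?_
    simp only [entropy_eq, mul_sub, mul_add, Finset.sum_sub_distrib, Finset.sum_add_distrib]
    simp only [hp, prod]
    ring
  have hsp : ∑ t, p t = 1 := sum_law (X.prod (Y.prod Z)) P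
  have hsq : ∑ t, q t = 1 := by
    rw [Fintype.sum_prod_type_right, ← sum_law (Y.prod Z) P]
    refine Finset.sum_congr rfl fun s _ => ?_
    simp only [hq]
    rw [← Finset.sum_mul, ← Finset.sum_div, sum_law_prod_left]
    by_cases h : Z.law P s.2 = 0
    · have := law_prod_le_right Y Z P s.1 s.2
      rw [h] at this
      rw [h, div_zero, zero_mul]
      exact le_antisymm (law_nonneg _ _ _) this
    · rw [div_self h, one_mul]
  have hCI : CondIndep P X Y Z ↔ ∀ t, p t = q t := by
    simp only [CondIndep, condLaw_eq, Prod.forall]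
    exact Iff.rfl
  have hD : (∀ t, p t = q t) ↔ ∑ t, p t * Real.log (p t / q t) = 0 := by
    constructor
    · intro h
      refine Finset.sum_eq_zero fun t _ => ?_
      by_cases h0 : q t = 0
      · rw [hpq t h0, zero_mul]
      · rw [h t, div_self h0, Real.log_one, mul_zero]
    · intro h
      have h1 : ∑ t, (p t * Real.log (p t / q t) - (p t - q t)) = 0 := by
        rw [Finset.sum_sub_distrib, Finset.sum_sub_distrib, h, hsp, hsq]
        ring
      rw [Finset.sum_eq_zero_iff_of_nonneg fun t _ =>
        sub_nonneg.2 (gibbs_term (hp0 t) (hq0 t) (hpq t)).1] at h1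
      exact fun t => (gibbs_term (hp0 t) (hq0 t) (hpq t)).2
        (sub_eq_zero.1 (h1 t (Finset.mem_univ t)))
  rw [hCI, hD, hsum]
  constructor <;> intro h <;> linarith

theorem condIndep_joint_iff {n : ℕ} (X : Fin n → DiscreteRV.{u, v} Ω) (P : Simplex Ω)
    (A B C : Finset (Fin n)) :
    CondIndep P (joint X A) (joint X B) (joint X C) ↔
      (joint X (A ∪ C)).entropy P + (joint X (B ∪ C)).entropy P =
        (joint X (A ∪ (B ∪ C))).entropy P + (joint X C).entropy P := by
  rw [condIndep_iff_entropy, entropy_joint_prod, entropy_joint_prod]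
  have : ((joint X A).prod ((joint X B).prod (joint X C))).entropy =
      (joint X (A ∪ (B ∪ C))).entropy := by
    refine entropy_congr fun ω ω' => ?_
    simp only [toFun_prod_eq_iff, toFun_joint_eq_iff, Finset.mem_union]
    grind
  rw [this]

end DiscreteRV

end EntropyDiagram
namespace EntropyDiagram

universe u v

/-! ### Existence and uniqueness of the entropy diagram. -/

section Diagram

open DiscreteRV

variable {Ω : Type u} [Fintype Ω] {n : ℕ}

theorem mem_region {L : Finset (Fin n)} {W : Atom n} : W ∈ region L ↔ ¬Disjoint W.1 L := by
  simp only [region, Set.mem_iUnion, Set.mem_ofPred_eq, Finset.not_disjoint_iff]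
  grind

/-- The entropy function `A ↦ H(X_A)`. -/
noncomputable def jointEntropy (X : Fin n → DiscreteRV.{u, v} Ω) (A : Finset (Fin n)) :
    Simplex Ω → ℝ :=
  (joint X A).entropy

/-- The chain rule turns `H(X_B)` into `H(X_{J ∪ B}) - H(X_J)`, and the constant cancels in the
alternating sum. If `J ⊆ Wᶜ`, the union with `J` changes nothing; otherwise the summands ignore an
element of `W ∩ J` and cancel in pairs. -/
theorem act_atomMass (X : Fin n → DiscreteRV.{u, v} Ω) (J : Finset (Fin n)) {W : Finset (Fin n)}
    (hW : W.Nonempty) : (joint X J).act (atomMass (jointEntropy X) W) =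
      if Disjoint W J then atomMass (jointEntropy X) W else 0 := by
  have hact : ∀ B, (joint X J).actHom (jointEntropy X B) =
      jointEntropy X (J ∪ B) - jointEntropy X J := fun B => by
    rw [actHom_apply, jointEntropy, act_entropy, entropy_joint_prod, jointEntropy, jointEntropy]
  have hconst : ∑ V ∈ W.powerset, (-1 : ℤ) ^ V.card • jointEntropy X J = 0 :=
    hW.elim fun j hj => sum_powerset_neg_one_pow_smul_eq_zero hj _ fun _ _ => rfl
  have h1 : (joint X J).act (atomMass (jointEntropy X) W) =
      -∑ V ∈ W.powerset, (-1 : ℤ) ^ V.card • jointEntropy X (J ∪ (Wᶜ ∪ V)) := by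
    rw [← actHom_apply, atomMass, map_neg, map_sum]
    simp only [map_zsmul, hact, smul_sub, Finset.sum_sub_distrib, hconst, sub_zero]
  rw [h1]
  split_ifs with h
  · have : ∀ V, J ∪ (Wᶜ ∪ V) = Wᶜ ∪ V := fun V => by
      rw [← Finset.union_assoc,
        Finset.union_eq_right.2 (Finset.subset_compl_iff_disjoint_left.2 h)]
    simp only [this]
    rfl
  · obtain ⟨j, hj, hjJ⟩ := Finset.not_disjoint_iff.1 h
    rw [neg_eq_zero]
    refine sum_powerset_neg_one_pow_smul_eq_zero hj _ fun V _ => ?_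
    congr 1
    grind

open Classical in
/-- The entropy diagram of `X`, as the sum of its atoms. -/
noncomputable def diagram (X : Fin n → DiscreteRV.{u, v} Ω) (S : Set (Atom n)) : Simplex Ω → ℝ :=
  ∑ W : Atom n with W ∈ S, atomMass (jointEntropy X) W.1

theorem diagram_singleton (X : Fin n → DiscreteRV.{u, v} Ω) (W : Atom n) :
    diagram X {W} = atomMass (jointEntropy X) W.1 := by
  classical
  rw [diagram]
  simp only [Set.mem_singleton_iff]
  rw [Finset.sum_filter, Finset.sum_ite_eq' _ W]
  simp

theorem diagram_union (X : Fin n → DiscreteRV.{u, v} Ω) {S T : Set (Atom n)} (h : Disjoint S T) :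
    diagram X (S ∪ T) = diagram X S + diagram X T := by
  classical
  simp only [diagram, Set.mem_union]
  rw [Finset.filter_or, Finset.sum_union]
  rw [Finset.disjoint_filter]
  exact fun W _ hS hT => Set.disjoint_left.1 h hS hT

theorem act_diagram (X : Fin n → DiscreteRV.{u, v} Ω) (J : Finset (Fin n)) (S : Set (Atom n)) :
    (joint X J).act (diagram X S) = diagram X (S \ region J) := by
  classical
  rw [diagram, ← actHom_apply, map_sum, diagram]
  simp only [actHom_apply, Set.mem_sdiff, mem_region, not_not]
  rw [← Finset.filter_filter, Finset.sum_filter (fun W : Atom n => Disjoint W.1 J)]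
  exact Finset.sum_congr rfl fun W _ => act_atomMass X J W.2

theorem diagram_region (X : Fin n → DiscreteRV.{u, v} Ω) (L : Finset (Fin n)) :
    diagram X (region L) = jointEntropy X L := by
  classical
  rw [← sum_atomMass_eq (jointEntropy X) (entropy_joint_empty X) L, diagram]
  refine Finset.sum_bij (fun W _ => W.1) ?_ ?_ ?_ ?_
  · intro W hW
    simpa [mem_region] using hW
  · exact fun W _ W' _ h => Subtype.ext h
  · intro W hW
    have hW' : ¬Disjoint W L := by simpa using hW
    obtain ⟨i, hi, -⟩ := Finset.not_disjoint_iff.1 hW'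
    exact ⟨⟨W, i, hi⟩, by simpa [mem_region] using hW', rfl⟩
  · exact fun _ _ => rfl

theorem interaction_joint (X : Fin n → DiscreteRV.{u, v} Ω) :
    ∀ (q : ℕ) (L : Fin (q + 1) → Finset (Fin n)),
      interaction q (fun k => joint X (L k)) = diagram X (⋂ k, region (L k))
  | 0, L => by
    have : (⋂ k, region (L k)) = region (L 0) := by
      ext W
      simp [Fin.forall_fin_one]
    rw [this, diagram_region]
    rfl
  | q + 1, L => by
    have ih := interaction_joint X q (Fin.init L)
    have h1 : interaction (q + 1) (fun k => joint X (L k)) =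
        interaction q (fun k => joint X (Fin.init L k)) - (joint X (L (Fin.last (q + 1)))).act
          (interaction q (fun k => joint X (Fin.init L k))) := rfl
    rw [h1, ih, act_diagram, sub_eq_iff_eq_add]
    set S := ⋂ k, region (Fin.init L k) with hS
    have h2 : (⋂ k, region (L k)) = S ∩ region (L (Fin.last (q + 1))) := by
      ext W
      simp only [hS, Set.mem_iInter, Set.mem_inter_iff, Fin.forall_fin_succ', Fin.init]
    rw [h2, ← diagram_union X (Set.disjoint_sdiff_right.mono_left Set.inter_subset_right),
      Set.inter_union_sdiff]

theorem isEntropyDiagram_diagram (X : Fin n → DiscreteRV.{u, v} Ω) :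
    IsEntropyDiagram X (diagram X) where
  measurable S := by
    classical
    have h : ∀ W, Measurable (atomMass (jointEntropy X) W) := fun W => by
      unfold atomMass
      refine Measurable.neg (Finset.sum_induction _ Measurable (fun _ _ => Measurable.add)
        measurable_zero fun V _ => ?_)
      exact (measurable_entropy _).const_smul _
    exact Finset.sum_induction _ Measurable (fun _ _ => Measurable.add) measurable_zero
      fun W _ => h W.1
  additive S T h := diagram_union X h
  hu q J L := by rw [interaction_joint, act_diagram]

theorem singleton_eq_iInter_region_diff (W : Atom n) {q : ℕ} (e : Fin (q + 1) ≃ W.1) :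
    ({W} : Set (Atom n)) = (⋂ k, region {(e k : Fin n)}) \ region (W.1)ᶜ := by
  ext V
  simp only [Set.mem_singleton_iff, Set.mem_sdiff, Set.mem_iInter, mem_region,
    Finset.disjoint_singleton_right, not_not, disjoint_compl_right_iff]
  constructor
  · rintro rfl
    exact ⟨fun k => (e k).2, subset_rfl⟩
  · rintro ⟨h1, h2⟩
    refine Subtype.ext (h2.antisymm fun i hi => ?_)
    simpa using h1 (e.symm ⟨i, hi⟩)

theorem IsEntropyDiagram.unique {X : Fin n → DiscreteRV.{u, v} Ω}
    {μ ν : Set (Atom n) → Simplex Ω → ℝ} (hμ : IsEntropyDiagram X μ)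
    (hν : IsEntropyDiagram X ν) : μ = ν := by
  have h0 : ∀ {μ : Set (Atom n) → Simplex Ω → ℝ}, IsEntropyDiagram X μ → μ ∅ = 0 := fun h => by
    simpa using h.additive ∅ ∅ (Set.disjoint_empty ∅)
  have h1 : ∀ W : Atom n, μ {W} = ν {W} := fun W => by
    obtain ⟨q, hq⟩ := Nat.exists_eq_succ_of_ne_zero (Finset.card_pos.2 W.2).ne'
    have e : Fin (q + 1) ≃ W.1 := (finCongr hq.symm).trans W.1.equivFin.symm
    rw [singleton_eq_iInter_region_diff W e, ← hμ.hu q _ fun k => {(e k : Fin n)},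
      ← hν.hu q _ fun k => {(e k : Fin n)}]
  funext S
  induction S, S.toFinite using Set.Finite.induction_on with
  | empty => rw [h0 hμ, h0 hν]
  | @insert W S hW _ ih =>
    have hd : Disjoint {W} S := Set.disjoint_singleton_left.2 hW
    rw [Set.insert_eq, hμ.additive _ _ hd, hν.additive _ _ hd, h1, ih]

theorem existsUnique_isEntropyDiagram (X : Fin n → DiscreteRV.{u, v} Ω) :
    ∃! μ : Set (Atom n) → Simplex Ω → ℝ, IsEntropyDiagram X μ :=
  ⟨diagram X, isEntropyDiagram_diagram X, fun _ h => h.unique (isEntropyDiagram_diagram X)⟩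

end Diagram

/-! ### Disconnected atoms and separation. -/

section Graph

variable {n : ℕ} {G : SimpleGraph (Fin n)}

theorem IsDisconnectedAtom.exists_separates {W : Atom n} (hW : IsDisconnectedAtom G W) :
    ∃ W₁ W₂ : Finset (Fin n), W₁.Nonempty ∧ W₂.Nonempty ∧ Disjoint W₁ W₂ ∧ W₁ ∪ W₂ = W.1 ∧
      Separates G (W.1)ᶜ W₁ W₂ := by
  classical
  rw [IsDisconnectedAtom, IsCutset, Finite.one_lt_card_iff_nontrivial] at hW
  obtain ⟨c, d, hcd⟩ := hW
  have hmem : ∀ i : {i | i ∉ Finset.univ \ W.1}, i.1 ∈ W.1 := fun i => by simpa using i.2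
  -- One side is a single component; the other is the rest of `W`.
  set T : Finset (Fin n) := W.1.filter fun i => ∃ h : i ∉ Finset.univ \ W.1,
    (G.induce {i | i ∉ Finset.univ \ W.1}).connectedComponentMk ⟨i, h⟩ = c with hT
  refine ⟨T, W.1 \ T, ?_, ?_, Finset.disjoint_sdiff,
    Finset.union_sdiff_of_subset (Finset.filter_subset _ _), ?_⟩
  · induction c using SimpleGraph.ConnectedComponent.ind with | _ i =>
    exact ⟨i.1, Finset.mem_filter.2 ⟨hmem i, i.2, rfl⟩⟩
  · induction d using SimpleGraph.ConnectedComponent.ind with | _ i =>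
    refine ⟨i.1, Finset.mem_sdiff.2 ⟨hmem i, fun h => ?_⟩⟩
    obtain ⟨-, h', h⟩ := Finset.mem_filter.1 h
    exact hcd h.symm
  · intro a ha b hb w
    by_contra! hw
    have hw' : ∀ x ∈ w.support, x ∈ {i | i ∉ Finset.univ \ W.1} := fun x hx => by
      have := mt (hw x) (not_not.2 hx)
      simpa using this
    obtain ⟨-, h', h⟩ := Finset.mem_filter.1 ha
    obtain ⟨hbW, hbT⟩ := Finset.mem_sdiff.1 hb
    refine hbT (Finset.mem_filter.2 ⟨hbW, by simpa using hbW, ?_⟩)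
    rw [← h]
    exact SimpleGraph.ConnectedComponent.sound ⟨(w.induce _ hw').reverse⟩

theorem isDisconnectedAtom_of_separates {W : Atom n} {A B C : Finset (Fin n)}
    (hsep : Separates G C A B) (hA : ¬Disjoint W.1 A) (hB : ¬Disjoint W.1 B)
    (hC : Disjoint W.1 C) : IsDisconnectedAtom G W := by
  obtain ⟨a, haW, ha⟩ := Finset.not_disjoint_iff.1 hA
  obtain ⟨b, hbW, hb⟩ := Finset.not_disjoint_iff.1 hB
  rw [IsDisconnectedAtom, IsCutset, Finite.one_lt_card_iff_nontrivial]
  refine ⟨SimpleGraph.connectedComponentMk _ ⟨a, by simpa using haW⟩,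
    SimpleGraph.connectedComponentMk _ ⟨b, by simpa using hbW⟩, fun h => ?_⟩
  obtain ⟨w⟩ := SimpleGraph.ConnectedComponent.exact h
  obtain ⟨c, hc, hcw⟩ := hsep a ha b hb (w.map (SimpleGraph.Embedding.induce _).toHom)
  obtain ⟨i, -, rfl⟩ := List.mem_map.1 ((SimpleGraph.Walk.support_map _ w) ▸ hcw)
  exact Finset.disjoint_left.1 hC (by simpa using i.2) hc

theorem Separates.mono {A A' B B' C : Finset (Fin n)} (h : Separates G C A B) (hA : A' ⊆ A)
    (hB : B' ⊆ B) : Separates G C A' B' :=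
  fun a ha b hb => h a (hA ha) b (hB hb)

end Graph

/-! ### The Markov property in terms of atoms. -/

section Markov

open DiscreteRV

variable {Ω : Type u} [Fintype Ω] {n : ℕ}

theorem diagram_singleton_apply (X : Fin n → DiscreteRV.{u, v} Ω) (W : Atom n) (P : Simplex Ω) :
    diagram X {W} P = atomMass (fun A => (joint X A).entropy P) W.1 := by
  rw [diagram_singleton]
  simp [atomMass, jointEntropy]

theorem atomMass_eq_zero_of_splits {M : Type*} [AddCommGroup M] (h : Finset (Fin n) → M)
    {W W₁ W₂ : Finset (Fin n)} (h₁ : W₁.Nonempty) (h₂ : W₂.Nonempty) (hd : Disjoint W₁ W₂)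
    (hW : W₁ ∪ W₂ = W)
    (hsplit : ∀ V₁ ⊆ W₁, ∀ V₂ ⊆ W₂, h (V₁ ∪ Wᶜ) + h (V₂ ∪ Wᶜ) = h (V₁ ∪ (V₂ ∪ Wᶜ)) + h Wᶜ) :
    atomMass h W = 0 := by
  obtain ⟨j₁, hj₁⟩ := h₁
  obtain ⟨j₂, hj₂⟩ := h₂
  have hj₁W : j₁ ∈ W := hW ▸ Finset.mem_union_left _ hj₁
  have hj₂W : j₂ ∈ W := hW ▸ Finset.mem_union_right _ hj₂
  have h21 : j₂ ∉ W₁ := fun h => Finset.disjoint_left.1 hd h hj₂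
  have h12 : j₁ ∉ W₂ := fun h => Finset.disjoint_left.1 hd hj₁ h
  -- The first term ignores `j₂`, the second `j₁`, the third both, so each alternating sum vanishes.
  have hV : ∀ V ∈ W.powerset, (-1 : ℤ) ^ V.card • h (Wᶜ ∪ V) =
      (-1 : ℤ) ^ V.card • h (V ∩ W₁ ∪ Wᶜ) + (-1 : ℤ) ^ V.card • h (V ∩ W₂ ∪ Wᶜ) -
        (-1 : ℤ) ^ V.card • h Wᶜ := fun V hV => by
    have hV' := Finset.mem_powerset.1 hV
    have h3 : V ∩ W₁ ∪ (V ∩ W₂ ∪ Wᶜ) = Wᶜ ∪ V := by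
      rw [← Finset.union_assoc, ← Finset.inter_union_distrib_left, hW, Finset.inter_eq_left.2 hV',
        Finset.union_comm]
    rw [← smul_add, ← smul_sub,
      hsplit _ Finset.inter_subset_right _ Finset.inter_subset_right, h3, add_sub_cancel_right]
  rw [atomMass, Finset.sum_congr rfl hV, Finset.sum_sub_distrib, Finset.sum_add_distrib,
    sum_powerset_neg_one_pow_smul_eq_zero hj₂W (fun V => h (V ∩ W₁ ∪ Wᶜ)),
    sum_powerset_neg_one_pow_smul_eq_zero hj₁W (fun V => h (V ∩ W₂ ∪ Wᶜ)),
    sum_powerset_neg_one_pow_smul_eq_zero hj₁W (fun _ => h Wᶜ) fun _ _ => rfl]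
  · simp
  · exact fun V _ => by simp only [Finset.insert_inter_of_notMem h12]
  · exact fun V _ => by simp only [Finset.insert_inter_of_notMem h21]

theorem entropy_joint_eq_sum (X : Fin n → DiscreteRV.{u, v} Ω) (P : Simplex Ω)
    (A : Finset (Fin n)) : (joint X A).entropy P =
      ∑ W : Atom n, if Disjoint W.1 A then 0 else diagram X {W} P := by
  classical
  have h := congrFun (diagram_region X A) P
  rw [jointEntropy] at h
  rw [← h, diagram, Finset.sum_apply, Finset.sum_filter]
  simp only [diagram_singleton, mem_region, ite_not]

theorem isMarkovRandomField_iff (X : Fin n → DiscreteRV.{u, v} Ω) (G : SimpleGraph (Fin n))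
    (P : Simplex Ω) : IsMarkovRandomField P X G ↔
      ∀ W : Atom n, IsDisconnectedAtom G W → diagram X {W} P = 0 := by
  constructor
  · intro hM W hW
    obtain ⟨W₁, W₂, h₁, h₂, hd, hW, hsep⟩ := hW.exists_separates
    rw [diagram_singleton_apply]
    refine atomMass_eq_zero_of_splits _ h₁ h₂ hd hW fun V₁ hV₁ V₂ hV₂ => ?_
    have hV₁W : V₁ ⊆ W.1 := hV₁.trans (hW ▸ Finset.subset_union_left)
    have hV₂W : V₂ ⊆ W.1 := hV₂.trans (hW ▸ Finset.subset_union_right)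
    -- Separation passes to subsets, so the Markov property applies to every pair `V₁`, `V₂`.
    exact (condIndep_joint_iff X P V₁ V₂ (W.1)ᶜ).1 (hM V₁ V₂ (W.1)ᶜ (hd.mono hV₁ hV₂)
      (disjoint_compl_right.mono_left hV₁W) (disjoint_compl_right.mono_left hV₂W)
      (hsep.mono hV₁ hV₂))
  · intro h A B C _ _ _ hsep
    rw [condIndep_joint_iff]
    simp only [entropy_joint_eq_sum, ← Finset.sum_add_distrib]
    -- Atom by atom, the two sides differ only where `W` meets `A` and `B` but misses `C`.
    refine Finset.sum_congr rfl fun W _ => ?_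
    simp only [Finset.disjoint_union_right]
    by_cases hC : Disjoint W.1 C
    · by_cases hA : Disjoint W.1 A
      · by_cases hB : Disjoint W.1 B <;> simp [hA, hB, hC]
      · by_cases hB : Disjoint W.1 B
        · simp [hA, hB, hC]
        · simp [h W (isDisconnectedAtom_of_separates hsep hA hB hC)]
    · simp [hC]

end Markov

end EntropyDiagram

theorem mainTheorem12 {Ω : Type*} [Fintype Ω] {n : ℕ}
    (X : Fin n → EntropyDiagram.DiscreteRV Ω) (G : SimpleGraph (Fin n)) :
    (∃! μ : Set (EntropyDiagram.Atom n) → EntropyDiagram.Simplex Ω → ℝ,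
      EntropyDiagram.IsEntropyDiagram X μ) ∧
    ∀ μ : Set (EntropyDiagram.Atom n) → EntropyDiagram.Simplex Ω → ℝ,
      EntropyDiagram.IsEntropyDiagram X μ →
      ∀ P : EntropyDiagram.Simplex Ω,
        EntropyDiagram.IsMarkovRandomField P X G ↔
          ∀ W : EntropyDiagram.Atom n, EntropyDiagram.IsDisconnectedAtom G W →
            EntropyDiagram.slice μ P {W} = 0 := by
  refine ⟨EntropyDiagram.existsUnique_isEntropyDiagram X, fun μ hμ P => ?_⟩
  rw [hμ.unique (EntropyDiagram.isEntropyDiagram_diagram X)]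
  exact EntropyDiagram.isMarkovRandomField_iff X G P
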